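/- Let $E$ and $F$ be Banach spaces over the same field $\mathbb K=\mathbb R$ or $\mathbb C$, and suppose there is a quotient mapping $\rho\colon E\to F$, that is, a surjective bounded linear operator such that $\|y\|=\inf\{\|x\|: x\in E,\ \rho(x)=y\}$ for every $y\in F$. For an integer $n\ge 1$ let $\mathcal P(^nE,F)$ be the space of continuous $n$-homogeneous polynomials $P\colon E\to F$ (continuous maps of the form $P(x)=A(x,\dots,x)$ with $A$ symmetric and $n$-linear), with the norm $\|P\|=\sup_{\|x\|\le 1}\|P(x)\|$, and let $\mathcal P_w(^nE,F)$ be the subspace of those $P$ that are weakly continuous on bounded sets, i.e. that map bounded weakly convergent nets of $E$ into norm convergent nets of $F$. A closed subspace $J$ of a Banach space $X$ is an $M$-ideal in $X$ if there is a linear projection $Q\colon X^*\to X^*$ with $\|Q\|\le 1$, whose kernel is $J^\perp=\{x^*\in X^*: x^*(y)=0 \text{ for all } y\in J\}$, such that $\|f\|=\|Qf\|+\|f-Qf\|$ for all $f\in X^*$. If $\mathcal P_w(^nE,F)$ is an $M$-ideal in $\mathcal P(^nE,F)$ for some integer $n\ge 1$, then $F$ (identified with its canonical image) is an $M$-ideal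 in its bidual $F^{**}$. -/

import Mathlib

noncomputable section

open Metric

section Polynomials

variable (𝕜 : Type*) [RCLike 𝕜] (n : ℕ)
  (E : Type*) [NormedAddCommGroup E] [NormedSpace 𝕜 E]
  (F : Type*) [NormedAddCommGroup F] [NormedSpace 𝕜 F]

/-- `P : E → F` is an `n`-homogeneous polynomial: there is a symmetric `n`-linear map `A` with
`P x = A (x, …, x)` for all `x`. -/
def IsHomogeneousPolynomial {E F : Type*} [NormedAddCommGroup E] [NormedSpace 𝕜 E]
    [NormedAddCommGroup F] [NormedSpace 𝕜 F] (P : E → F) : Prop :=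
  ∃ A : MultilinearMap 𝕜 (fun _ : Fin n => E) F,
    (∀ (σ : Equiv.Perm (Fin n)) (v : Fin n → E), A (fun i => v (σ i)) = A v) ∧
      ∀ x, P x = A (fun _ => x)

/-- The continuous `n`-homogeneous polynomials, as a vector space of functions. -/
def continuousPolynomialSubmodule : Submodule 𝕜 (E → F) where
  carrier := {P | IsHomogeneousPolynomial 𝕜 n P ∧ Continuous P}
  zero_mem' := ⟨⟨0, by simp, by simp⟩, continuous_const⟩
  add_mem' := by
    rintro P Q ⟨⟨A, hA, hP⟩, hPc⟩ ⟨⟨B, hB, hQ⟩, hQc⟩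
    exact ⟨⟨A + B, by simp [hA, hB], by simp [hP, hQ]⟩, hPc.add hQc⟩
  smul_mem' := by
    rintro c P ⟨⟨A, hA, hP⟩, hPc⟩
    exact ⟨⟨c • A, by simp [hA], by simp [hP]⟩, hPc.const_smul c⟩

/-- The space `𝓟(ⁿE, F)` of continuous `n`-homogeneous polynomials from `E` to `F`. It is a type of
its own, so that it carries the norm topology defined below and not that of pointwise
convergence. -/
def ContinuousPolynomial : Type _ := continuousPolynomialSubmodule 𝕜 n E F

namespace ContinuousPolynomial

instance : AddCommGroup (ContinuousPolynomial 𝕜 n E F) :=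
  inferInstanceAs (AddCommGroup (continuousPolynomialSubmodule 𝕜 n E F))

instance : Module 𝕜 (ContinuousPolynomial 𝕜 n E F) :=
  inferInstanceAs (Module 𝕜 (continuousPolynomialSubmodule 𝕜 n E F))

instance : FunLike (ContinuousPolynomial 𝕜 n E F) E F where
  coe P := P.1
  coe_injective _ _ h := Subtype.ext h

variable {𝕜 n E F}

@[simp] theorem zero_apply (x : E) : (0 : ContinuousPolynomial 𝕜 n E F) x = 0 := rfl

@[simp] theorem add_apply (P Q : ContinuousPolynomial 𝕜 n E F) (x : E) :
    (P + Q) x = P x + Q x := rfl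

@[simp] theorem smul_apply (c : 𝕜) (P : ContinuousPolynomial 𝕜 n E F) (x : E) :
    (c • P) x = c • P x := rfl

theorem map_smul_pow (P : ContinuousPolynomial 𝕜 n E F) (c : 𝕜) (x : E) :
    P (c • x) = c ^ n • P x := by
  obtain ⟨A, -, hA⟩ := P.2.1
  change P.1 (c • x) = c ^ n • P.1 x
  rw [hA, hA]
  simpa using A.map_smul_univ (fun _ => c) (fun _ => x)

theorem exists_bound (P : ContinuousPolynomial 𝕜 n E F) :
    ∃ C : ℝ, ∀ x ∈ closedBall (0 : E) 1, ‖P x‖ ≤ C := by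
  obtain ⟨δ, hδ, h⟩ := Metric.continuous_iff.1 P.2.2 0 1 one_pos
  have hδ2 : 0 < δ / 2 := by positivity
  refine ⟨(‖P 0‖ + 1) / (δ / 2) ^ n, fun x hx => ?_⟩
  have hx1 : ‖x‖ ≤ 1 := by simpa using hx
  have h1 : dist (P (((δ / 2 : ℝ) : 𝕜) • x)) (P 0) < 1 := by
    refine h _ ?_
    rw [dist_zero_right, norm_smul, RCLike.norm_ofReal, abs_of_pos hδ2]
    nlinarith
  have h2 : ‖P (((δ / 2 : ℝ) : 𝕜) • x)‖ ≤ ‖P 0‖ + 1 := by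
    rw [dist_eq_norm] at h1
    have := norm_le_norm_add_norm_sub' (P (((δ / 2 : ℝ) : 𝕜) • x)) (P 0)
    linarith
  rw [map_smul_pow, norm_smul, norm_pow, RCLike.norm_ofReal, abs_of_pos hδ2] at h2
  rw [le_div_iff₀ (by positivity)]
  linarith

/-- The supremum norm over the closed unit ball. -/
instance : Norm (ContinuousPolynomial 𝕜 n E F) where
  norm P := sSup ((fun x => ‖P x‖) '' closedBall (0 : E) 1)

theorem norm_def (P : ContinuousPolynomial 𝕜 n E F) :
    ‖P‖ = sSup ((fun x => ‖P x‖) '' closedBall (0 : E) 1) := rfl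

/-- The supremum defining the norm is a genuine one. -/
theorem isLUB_norm (P : ContinuousPolynomial 𝕜 n E F) :
    IsLUB ((fun x => ‖P x‖) '' closedBall (0 : E) 1) ‖P‖ := by
  refine isLUB_csSup ⟨‖P 0‖, 0, by simp, rfl⟩ ?_
  obtain ⟨C, hC⟩ := P.exists_bound
  exact ⟨C, by rintro _ ⟨x, hx, rfl⟩; exact hC x hx⟩

theorem norm_apply_le (P : ContinuousPolynomial 𝕜 n E F) {x : E} (hx : ‖x‖ ≤ 1) :
    ‖P x‖ ≤ ‖P‖ :=
  P.isLUB_norm.1 ⟨x, by simpa using hx, rfl⟩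

theorem norm_le {P : ContinuousPolynomial 𝕜 n E F} {C : ℝ}
    (h : ∀ x : E, ‖x‖ ≤ 1 → ‖P x‖ ≤ C) : ‖P‖ ≤ C :=
  P.isLUB_norm.2 (by rintro _ ⟨x, hx, rfl⟩; exact h x (by simpa using hx))

theorem normCore : NormedSpace.Core 𝕜 (ContinuousPolynomial 𝕜 n E F) where
  norm_nonneg P := (norm_nonneg (P 0)).trans (P.norm_apply_le (by simp))
  norm_smul c P := by
    refine le_antisymm (norm_le fun x hx => ?_) ?_
    · rw [smul_apply, _root_.norm_smul]
      exact mul_le_mul_of_nonneg_left (P.norm_apply_le hx) (norm_nonneg c)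
    · rcases eq_or_ne c 0 with rfl | hc
      · rw [norm_zero, zero_mul]
        exact (norm_nonneg _).trans (norm_apply_le ((0 : 𝕜) • P) (x := 0) (by simp))
      · have hc' : 0 < ‖c‖ := norm_pos_iff.2 hc
        rw [← le_div_iff₀' hc']
        refine norm_le fun x hx => ?_
        rw [le_div_iff₀' hc', ← _root_.norm_smul, ← smul_apply]
        exact norm_apply_le _ hx
  norm_triangle P Q := norm_le fun x hx =>
    (norm_add_le (P x) (Q x)).trans (add_le_add (P.norm_apply_le hx) (Q.norm_apply_le hx))
  norm_eq_zero_iff P := by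
    refine ⟨fun h => DFunLike.ext _ _ fun x => ?_, ?_⟩
    · have hr : (0 : ℝ) < (‖x‖ + 1)⁻¹ := by positivity
      have hy : ‖(((‖x‖ + 1)⁻¹ : ℝ) : 𝕜) • x‖ ≤ 1 := by
        rw [_root_.norm_smul, RCLike.norm_ofReal, abs_of_pos hr, inv_mul_le_iff₀ (by positivity)]
        linarith
      have h0 : P ((((‖x‖ + 1)⁻¹ : ℝ) : 𝕜) • x) = 0 :=
        norm_le_zero_iff.1 ((P.norm_apply_le hy).trans h.le)
      rw [map_smul_pow] at h0
      exact (smul_eq_zero.1 h0).resolve_left (pow_ne_zero _ (RCLike.ofReal_ne_zero.2 hr.ne'))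
    · rintro rfl
      exact le_antisymm (norm_le fun x _ => by simp)
        ((norm_nonneg _).trans (norm_apply_le (0 : ContinuousPolynomial 𝕜 n E F) (x := 0)
          (by simp)))

instance : NormedAddCommGroup (ContinuousPolynomial 𝕜 n E F) :=
  NormedAddCommGroup.ofCore (𝕜 := 𝕜) normCore

instance : NormedSpace 𝕜 (ContinuousPolynomial 𝕜 n E F) where
  norm_smul_le c P := (normCore.norm_smul c P).le

variable (𝕜 n E F)

/-- The subspace `𝓟_w(ⁿE, F)` of polynomials that are weakly continuous on bounded sets: whenever
`x` runs through a bounded net (a filter containing a bounded set) that converges weakly in `E`,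
`P x` converges in the norm of `F`. -/
def weaklyContinuousOnBounded : Submodule 𝕜 (ContinuousPolynomial 𝕜 n E F) where
  carrier := {P | ∀ (l : Filter E) (x₀ : E), (∃ B ∈ l, Bornology.IsBounded B) →
    Filter.Tendsto (fun x => toWeakSpace 𝕜 E x) l (nhds (toWeakSpace 𝕜 E x₀)) →
      ∃ y : F, Filter.Tendsto P l (nhds y)}
  zero_mem' := fun _ _ _ _ => ⟨0, tendsto_const_nhds⟩
  add_mem' := fun hP hQ l x₀ hB hl => by
    obtain ⟨y, hy⟩ := hP l x₀ hB hl
    obtain ⟨z, hz⟩ := hQ l x₀ hB hl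
    exact ⟨y + z, hy.add hz⟩
  smul_mem' := fun c _ hP l x₀ hB hl => by
    obtain ⟨y, hy⟩ := hP l x₀ hB hl
    exact ⟨c • y, hy.const_smul c⟩

end ContinuousPolynomial

end Polynomials

section Ideals

variable {𝕜 : Type*} [RCLike 𝕜] {X : Type*} [NormedAddCommGroup X] [NormedSpace 𝕜 X]

/-- `Q` is a contractive linear projection on the dual `X*` whose kernel is the annihilator
of `J`. (For `J ≠ 0` its norm is then exactly one; for `J = 0` it is the zero map.) -/
structure IsIdealProjection (J : Submodule 𝕜 X)
    (Q : StrongDual 𝕜 X →L[𝕜] StrongDual 𝕜 X) : Prop where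
  proj : ∀ f, Q (Q f) = Q f
  norm_le_one : ‖Q‖ ≤ 1
  ker_eq : ∀ f, Q f = 0 ↔ ∀ y ∈ J, f y = 0

variable (𝕜 X) in
/-- The closed subspace `J` is an `M`-ideal in `X`. -/
def IsMIdeal (J : Submodule 𝕜 X) : Prop :=
  IsClosed (J : Set X) ∧ ∃ Q : StrongDual 𝕜 X →L[𝕜] StrongDual 𝕜 X,
    IsIdealProjection J Q ∧ ∀ f, ‖f‖ = ‖Q f‖ + ‖f - Q f‖

end Ideals

/-- A quotient mapping between normed spaces: a surjective bounded operator for which the norm of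
`F` is the quotient norm of `E ⧸ ker ρ`. -/
def IsQuotientMapping {𝕜 : Type*} [RCLike 𝕜] {E : Type*} [NormedAddCommGroup E] [NormedSpace 𝕜 E]
    {F : Type*} [NormedAddCommGroup F] [NormedSpace 𝕜 F] (ρ : E →L[𝕜] F) : Prop :=
  (AddMonoidHom.mkNormedAddGroupHom (ρ : E →+ F) ‖ρ‖ ρ.le_opNorm).IsQuotient

end

/-!
Fix `Φ ∈ F**` of norm one. By Goldstine's theorem and the quotient property of `ρ` there is an
ultrafilter on the unit ball of `E` along which `g (ρ x) → Φ g` for all `g ∈ F*`. Taking weak-*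
limits of `P x` along it defines a contraction `S : 𝓟(ⁿ⁺¹E, F) → F**`, a substitute for evaluating
`P` at a preimage of `Φ` in `E**`; it sends `x ↦ φ (ρ x) ^ n • T (ρ x)` to `Φ φ ^ n • T** Φ`. The
ultrafilter is only weakly Cauchy, but a polynomial that is weakly continuous on bounded sets
maps bounded weakly Cauchy filters to norm Cauchy ones, so `S` maps `𝓟_w` into `F`.

Let `g ∈ F*` and `k ∈ F^⊥ ⊆ F***`. Then `k ∘ S` annihilates `𝓟_w`, whereas `g ∘ S` already has norm
`‖g‖` on `𝓟_w`, as finite-rank `T` show. The `M`-ideal property makes the norms of two such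
functionals add up, so `‖g‖ + |k Φ| ≤ ‖(g + k) ∘ S‖ ≤ ‖g + k‖`, where `T = id` gives
`|k Φ| ≤ ‖k ∘ S‖`. Hence `‖g‖ + ‖k‖ = ‖g + k‖`, which says that `F` is an `M`-ideal in `F**`.
-/

open Metric Filter Topology NormedSpace

section BidualApproximation

variable {𝕜 : Type*} [RCLike 𝕜] {X Y : Type*} [NormedAddCommGroup X] [NormedSpace 𝕜 X]
  [NormedAddCommGroup Y] [NormedSpace 𝕜 Y]

theorem opNorm_le_of_forall_mem_ball_re_le (g : StrongDual 𝕜 X) {r : ℝ}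
    (h : ∀ x ∈ ball (0 : X) 1, RCLike.re (g x) ≤ r) : ‖g‖ ≤ r := by
  by_contra! hr
  obtain ⟨x, hx, hrx⟩ := g.exists_lt_apply_of_lt_opNorm hr
  obtain ⟨c, hc, hcx⟩ := RCLike.exists_norm_eq_mul_self (g x)
  have hgcx : RCLike.re (g (c • x)) = ‖g x‖ := by
    rw [map_smul, smul_eq_mul, ← hcx, RCLike.ofReal_re]
  have hcx_mem : c • x ∈ ball (0 : X) 1 := by
    rwa [mem_ball_zero_iff, norm_smul, hc, one_mul]
  linarith [h _ hcx_mem]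

theorem mem_closure_weakBilin_of_forall_re_le {V W : Type*} [AddCommGroup V] [Module 𝕜 V]
    [Module ℝ V] [IsScalarTower ℝ 𝕜 V] [AddCommGroup W] [Module 𝕜 W] {B : V →ₗ[𝕜] W →ₗ[𝕜] 𝕜}
    {S : Set (WeakBilin B)} (hS : Convex ℝ S) {v : WeakBilin B}
    (h : ∀ (w : W) (r : ℝ), (∀ s ∈ S, RCLike.re (B s w) ≤ r) → RCLike.re (B v w) ≤ r) :
    v ∈ closure S := by
  have : IsScalarTower ℝ 𝕜 (WeakBilin B) := inferInstanceAs (IsScalarTower ℝ 𝕜 V)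
  have : ContinuousSMul ℝ (WeakBilin B) := IsScalarTower.continuousSMul 𝕜
  by_contra hv
  obtain ⟨Λ, r, hΛS, hΛv⟩ :=
    RCLike.geometric_hahn_banach_closed_point (𝕜 := 𝕜) hS.closure isClosed_closure hv
  obtain ⟨w, rfl⟩ := LinearMap.dualEmbedding_surjective B Λ
  exact hΛv.not_ge (h w r fun s hs => (hΛS s (subset_closure hs)).le)

theorem exists_ultrafilter_tendsto_of_forall_re_le {V W : Type*} [AddCommGroup V] [Module 𝕜 V]
    [Module ℝ V] [IsScalarTower ℝ 𝕜 V] [AddCommGroup W] [Module 𝕜 W] (T : V →ₗ[𝕜] W →ₗ[𝕜] 𝕜)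
    {S : Set V} (hS : Convex ℝ S) {φ : W →ₗ[𝕜] 𝕜}
    (h : ∀ (w : W) (r : ℝ), (∀ s ∈ S, RCLike.re (T s w) ≤ r) → RCLike.re (φ w) ≤ r) :
    ∃ U : Ultrafilter V, S ∈ U ∧ ∀ w, Tendsto (fun v => T v w) U (𝓝 (φ w)) := by
  let B : (W →ₗ[𝕜] 𝕜) →ₗ[𝕜] W →ₗ[𝕜] 𝕜 := LinearMap.id
  let _ : IsScalarTower ℝ 𝕜 (WeakBilin B) := inferInstanceAs (IsScalarTower ℝ 𝕜 (W →ₗ[𝕜] 𝕜))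
  let TB : V →ₗ[𝕜] WeakBilin B := T
  let φB : WeakBilin B := φ
  have hTS : Convex ℝ (TB '' S) := hS.linear_image (TB.restrictScalars ℝ)
  have hφ : φB ∈ closure (TB '' S) := mem_closure_weakBilin_of_forall_re_le hTS fun w r hr =>
    h w r fun s hs => hr _ ⟨s, hs, rfl⟩
  rw [mem_closure_iff_clusterPt, ← map_principal] at hφ
  obtain ⟨U, hU, hUφ⟩ := mapClusterPt_iff_ultrafilter.1 hφ
  exact ⟨U, le_principal_iff.1 hU, fun w => ((WeakBilin.eval_continuous B w).tendsto φB).comp hUφ⟩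

theorem goldstine {Φ : StrongDual 𝕜 (StrongDual 𝕜 X)} (hΦ : ‖Φ‖ ≤ 1) :
    ∃ U : Ultrafilter X, ball 0 1 ∈ U ∧
      ∀ g : StrongDual 𝕜 X, Tendsto g U (𝓝 (Φ g)) := by
  let _ : NormedSpace ℝ X := NormedSpace.restrictScalars ℝ 𝕜 X
  have : IsScalarTower ℝ 𝕜 X := .of_algebraMap_smul fun _ _ => rfl
  refine exists_ultrafilter_tendsto_of_forall_re_le (topDualPairing 𝕜 X).flip (convex_ball 0 1)
    (φ := Φ.toLinearMap) fun g r hg => ?_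
  calc RCLike.re (Φ g) ≤ ‖Φ g‖ := RCLike.re_le_norm _
    _ ≤ 1 * ‖g‖ := Φ.le_of_opNorm_le hΦ g
    _ ≤ r := by rw [one_mul]; exact opNorm_le_of_forall_mem_ball_re_le g hg

theorem exists_ultrafilter_limit_of_norm_le {α : Type*} [ProperSpace X]
    (U : Ultrafilter α) {u : α → X} {C : ℝ} (hu : ∀ᶠ a in U, ‖u a‖ ≤ C) :
    ∃ x, ‖x‖ ≤ C ∧ Tendsto u U (𝓝 x) := by
  obtain ⟨x, hx, hUx⟩ := (isCompact_closedBall (0 : X) C).ultrafilter_le_nhds (U.map u)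
    (le_principal_iff.2 (hu.mono fun _ => mem_closedBall_zero_iff.2))
  exact ⟨x, mem_closedBall_zero_iff.1 hx, hUx⟩

set_option maxSynthPendingDepth 6 in
theorem exists_tendsto_bidual {α : Type*} (U : Ultrafilter α) (T : α → X →ₗ[𝕜] Y) {C : ℝ}
    (hC : 0 ≤ C) (hT : ∀ x, ∀ᶠ a in U, ‖T a x‖ ≤ C * ‖x‖) :
    ∃ S : X →L[𝕜] StrongDual 𝕜 (StrongDual 𝕜 Y), ‖S‖ ≤ C ∧
      ∀ x g, Tendsto (fun a => g (T a x)) U (𝓝 (S x g)) := by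
  have hlim (x : X) (g : StrongDual 𝕜 Y) :
      ∃ c, ‖c‖ ≤ C * ‖x‖ * ‖g‖ ∧ Tendsto (fun a => g (T a x)) U (𝓝 c) :=
    exists_ultrafilter_limit_of_norm_le U <| by
      filter_upwards [hT x] with a ha
      rw [mul_comm]
      exact g.le_opNorm_of_le ha
  choose L hL_le hL using hlim
  let S : X →ₗ[𝕜] StrongDual 𝕜 Y →ₗ[𝕜] 𝕜 := LinearMap.mk₂ 𝕜 L
    (fun x x' g => tendsto_nhds_unique (hL _ g) (by simpa using (hL x g).add (hL x' g)))
    (fun c x g => tendsto_nhds_unique (hL _ g) (by simpa using (hL x g).const_mul c))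
    (fun x g g' => tendsto_nhds_unique (hL x _) (by simpa using (hL x g).add (hL x g')))
    (fun c x g => tendsto_nhds_unique (hL x _) (by simpa using (hL x g).const_mul c))
  exact ⟨S.mkContinuous₂ C hL_le, S.mkContinuous₂_norm_le hC hL_le, hL⟩

theorem opNorm_comp_le_of_opNorm_le_one {Z : Type*} [NormedAddCommGroup Z] [NormedSpace 𝕜 Z]
    (f : Y →L[𝕜] Z) {T : X →L[𝕜] Y} (hT : ‖T‖ ≤ 1) : ‖f.comp T‖ ≤ ‖f‖ :=
  (f.opNorm_comp_le T).trans (mul_le_of_le_one_right (norm_nonneg f) hT)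

theorem opNorm_pow_mul_le (T : X →L[𝕜] Y) (n : ℕ) {a C : ℝ}
    (h : ∀ x, ‖x‖ ≤ 1 → ‖T x‖ ^ n * a ≤ C) : ‖T‖ ^ n * a ≤ C := by
  have hclosed : IsClosed {t : ℝ | t ^ n * a ≤ C} := isClosed_le (by fun_prop) continuous_const
  have hbdd : BddAbove ((fun x => ‖T x‖) '' closedBall 0 1) :=
    ⟨‖T‖, by rintro _ ⟨x, hx, rfl⟩; exact T.unit_le_opNorm x (by simpa using hx)⟩
  have hsup := csSup_mem_closure ((nonempty_closedBall.2 zero_le_one).image _) hbdd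
  rw [T.sSup_unitClosedBall_eq_norm] at hsup
  refine closure_minimal ?_ hclosed hsup
  rintro _ ⟨x, hx, rfl⟩
  exact h x (by simpa using hx)

end BidualApproximation

section FrechetPolynomials

open fwdDiff_aux

/-- The maps `f : M → G` that are polynomials of degree less than `n` in the sense of Fréchet:
all `n`-fold differences `Δ_[v₁] ⋯ Δ_[vₙ] f` vanish. -/
def frechetDegreeLT (M G : Type*) [AddCommMonoid M] [AddCommGroup G] : ℕ → AddSubgroup (M → G)
  | 0 => ⊥
  | n + 1 => ⨅ v, (frechetDegreeLT M G n).comap (fwdDiffₗ M G v).toAddMonoidHom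

theorem mem_frechetDegreeLT_succ {M G : Type*} [AddCommMonoid M] [AddCommGroup G] {n : ℕ}
    {f : M → G} :
    f ∈ frechetDegreeLT M G (n + 1) ↔ ∀ v, fwdDiff v f ∈ frechetDegreeLT M G n := by
  simp only [frechetDegreeLT, AddSubgroup.mem_iInf, AddSubgroup.mem_comap]
  rfl

variable {R ι M G : Type*} [CommSemiring R] [AddCommMonoid M] [Module R M] [AddCommGroup G]
  [Module R G]

theorem fwdDiff_multilinear_piecewise [DecidableEq ι] (A : MultilinearMap R (fun _ : ι => M) G)
    (t : Finset ι) (c : ι → M) (v : M) :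
    fwdDiff v (fun x => A (t.piecewise (fun _ => x) c)) =
      ∑ s ∈ t.ssubsets, fun x => A (s.piecewise (fun _ => x) (t.piecewise (fun _ => v) c)) := by
  ext x
  have hshift : t.piecewise (fun _ => x + v) c =
      t.piecewise ((fun _ => x) + t.piecewise (fun _ => v) c) (t.piecewise (fun _ => v) c) := by
    ext i
    by_cases hi : i ∈ t <;> simp [hi]
  have htop : t.piecewise (fun _ => x) (t.piecewise (fun _ => v) c) =
      t.piecewise (fun _ => x) c := by
    ext i
    by_cases hi : i ∈ t <;> simp [hi]
  rw [fwdDiff, hshift, A.map_piecewise_add, ← Finset.sum_erase_add _ _ t.mem_powerset_self, htop,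
    add_sub_cancel_right, Finset.sum_apply, Finset.ssubsets]

theorem multilinear_piecewise_mem_frechetDegreeLT [DecidableEq ι]
    (A : MultilinearMap R (fun _ : ι => M) G) {n : ℕ} {t : Finset ι} (ht : t.card < n)
    (c : ι → M) :
    (fun x => A (t.piecewise (fun _ => x) c)) ∈ frechetDegreeLT M G n := by
  induction n generalizing t c with
  | zero => simp at ht
  | succ n ih =>
    refine mem_frechetDegreeLT_succ.2 fun v => ?_
    rw [fwdDiff_multilinear_piecewise]
    refine sum_mem fun s hs => ih ?_ _
    have := Finset.card_lt_card (Finset.mem_ssubsets.1 hs)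
    omega

end FrechetPolynomials

theorem cauchy_map_of_forall_exists_dist_lt {α β : Type*} [PseudoMetricSpace β] {l : Filter α}
    [l.NeBot] {f : α → β}
    (h : ∀ ε > 0, ∃ g : α → β, Cauchy (l.map g) ∧ ∀ᶠ a in l, dist (f a) (g a) < ε) :
    Cauchy (l.map f) := by
  refine cauchy_map_iff'.2 (Metric.uniformity_basis_dist.tendsto_right_iff.2 fun ε hε => ?_)
  obtain ⟨g, hg, hfg⟩ := h (ε / 3) (by positivity)
  have hgg := Metric.uniformity_basis_dist.tendsto_right_iff.1 (cauchy_map_iff'.1 hg) (ε / 3)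
    (by positivity)
  filter_upwards [hgg, hfg.prod_mk hfg] with p hp hfp
  have htri := dist_triangle4_right (f p.1) (f p.2) (g p.1) (g p.2)
  change dist (f p.1) (f p.2) < ε
  linarith [hfp.1, hfp.2, show dist (g p.1) (g p.2) < ε / 3 from hp]

section WeakContinuity

variable {𝕜 : Type*} [RCLike 𝕜] {E : Type*} [NormedAddCommGroup E] [NormedSpace 𝕜 E]
  {F : Type*} [NormedAddCommGroup F]

theorem tendsto_toWeakSpace_iff {α : Type*} {l : Filter α} {u : α → E} {x₀ : E} :
    Tendsto (fun a => toWeakSpace 𝕜 E (u a)) l (𝓝 (toWeakSpace 𝕜 E x₀)) ↔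
      ∀ φ : StrongDual 𝕜 E, Tendsto (fun a => φ (u a)) l (𝓝 (φ x₀)) :=
  WeakBilin.tendsto_iff_forall_eval_tendsto (topDualPairing 𝕜 E).flip
    fun _ _ h => (SeparatingDual.eq_iff_forall_dual_eq (R := 𝕜)).2 fun φ => LinearMap.congr_fun h φ

variable (𝕜) in
/-- `f` maps bounded weakly convergent filters to norm convergent ones. This is the condition
defining `ContinuousPolynomial.weaklyContinuousOnBounded`, for maps that need not be homogeneous
polynomials. -/
def IsWeaklyContinuousOnBounded (f : E → F) : Prop :=
  ∀ (l : Filter E) (x₀ : E), (∃ B ∈ l, Bornology.IsBounded B) →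
    Tendsto (fun x => toWeakSpace 𝕜 E x) l (𝓝 (toWeakSpace 𝕜 E x₀)) → ∃ y : F, Tendsto f l (𝓝 y)

namespace IsWeaklyContinuousOnBounded

variable {f : E → F}

theorem exists_tendsto_comp (hf : IsWeaklyContinuousOnBounded 𝕜 f) {α : Type*} {l : Filter α}
    {u : α → E} {x₀ : E} {r : ℝ} (hr : ∀ᶠ a in l, ‖u a‖ ≤ r)
    (hu : ∀ φ : StrongDual 𝕜 E, Tendsto (fun a => φ (u a)) l (𝓝 (φ x₀))) :
    ∃ y, Tendsto (fun a => f (u a)) l (𝓝 y) :=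
  hf (l.map u) x₀ ⟨closedBall 0 r, hr.mono fun _ => mem_closedBall_zero_iff.2, isBounded_closedBall⟩
    (tendsto_map'_iff.2 (tendsto_toWeakSpace_iff.2 hu))

protected theorem fwdDiff (hf : IsWeaklyContinuousOnBounded 𝕜 f) (v : E) :
    IsWeaklyContinuousOnBounded 𝕜 (fwdDiff v f) := by
  intro l x₀ hB hl
  obtain ⟨y, hy⟩ := hf l x₀ hB hl
  obtain ⟨B, hBl, hB⟩ := hB
  obtain ⟨r, hr⟩ := isBounded_iff_forall_norm_le.1 hB
  obtain ⟨z, hz⟩ := hf.exists_tendsto_comp (u := fun x => x + v) (x₀ := x₀ + v) (r := r + ‖v‖)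
    (by filter_upwards [hBl] with x hx using norm_add_le_of_le (hr x hx) le_rfl)
    (fun φ => by simpa using (tendsto_toWeakSpace_iff.1 hl φ).add_const (φ v))
  exact ⟨z - y, hz.sub hy⟩

/- Along `l ×ˢ l` the differences `x - v` tend weakly to `0`, so `f (x - v)` is nearly constant;
hence `f x = f (x - v) - Δ_[-v] f x` is uniformly close to a constant minus `Δ_[-v] f x`, which has
lower degree. -/
theorem cauchy_map {n : ℕ} (hf : IsWeaklyContinuousOnBounded 𝕜 f)
    (hn : f ∈ frechetDegreeLT E F n) {l : Filter E} [l.NeBot] {r : ℝ} (hr : ∀ᶠ x in l, ‖x‖ ≤ r)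
    (hl : ∀ φ : StrongDual 𝕜 E, Cauchy (l.map φ)) : Cauchy (l.map f) := by
  induction n generalizing f with
  | zero =>
    obtain rfl : f = 0 := hn
    exact (tendsto_const_nhds (x := (0 : F))).cauchy_map
  | succ n ih =>
    obtain ⟨y, hy⟩ : ∃ y, Tendsto (fun p : E × E => f (p.2 - p.1)) (l ×ˢ l) (𝓝 y) := by
      refine hf.exists_tendsto_comp (x₀ := 0) (r := r + r) ?_ fun φ => ?_
      · filter_upwards [hr.prod_mk hr] with p hp using norm_sub_le_of_le hp.2 hp.1
      · have hφ := (cauchy_map_iff'.1 (hl φ))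
        rw [uniformity_eq_comap_nhds_zero, tendsto_comap_iff] at hφ
        simpa [Function.comp_def] using hφ
    refine cauchy_map_of_forall_exists_dist_lt fun ε hε => ?_
    obtain ⟨v, hv⟩ := (hy.eventually (ball_mem_nhds y hε)).curry.exists
    refine ⟨fun x => y - fwdDiff (-v) f x, ?_, ?_⟩
    · exact (ih (hf.fwdDiff (-v)) (mem_frechetDegreeLT_succ.1 hn (-v))).map
        (uniformContinuous_const.sub uniformContinuous_id)
    · filter_upwards [hv] with x hx
      rw [dist_eq_norm] at hx ⊢
      convert hx using 2
      simp only [fwdDiff, sub_eq_add_neg x v]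
      abel

end IsWeaklyContinuousOnBounded

end WeakContinuity

section HomogeneousPolynomials

variable {𝕜 : Type*} [RCLike 𝕜] {n : ℕ}
  {E : Type*} [NormedAddCommGroup E] [NormedSpace 𝕜 E]
  {F : Type*} [NormedAddCommGroup F] [NormedSpace 𝕜 F]

theorem isHomogeneousPolynomial_diagonal (A : MultilinearMap 𝕜 (fun _ : Fin n => E) F) :
    IsHomogeneousPolynomial 𝕜 n fun x => A fun _ => x := by
  refine ⟨(n.factorial : 𝕜)⁻¹ • ∑ σ : Equiv.Perm (Fin n), A.domDomCongr σ, fun τ v => ?_,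
    fun x => ?_⟩
  · simp only [smul_apply, sum_apply, MultilinearMap.domDomCongr_apply]
    congr 1
    exact Fintype.sum_equiv (Equiv.mulLeft τ) _ _ fun σ => rfl
  · have h : (n.factorial : 𝕜) ≠ 0 := Nat.cast_ne_zero.2 n.factorial_ne_zero
    simp [Fintype.card_perm, ← Nat.cast_smul_eq_nsmul 𝕜, smul_smul, h]

namespace ContinuousPolynomial

theorem mem_frechetDegreeLT (P : ContinuousPolynomial 𝕜 n E F) :
    ⇑P ∈ frechetDegreeLT E F (n + 1) := by
  obtain ⟨A, -, hA⟩ := P.2.1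
  have h := multilinear_piecewise_mem_frechetDegreeLT A (t := .univ) (by simp : _ < n + 1) 0
  simp only [Finset.piecewise_univ, ← hA] at h
  exact h

theorem exists_tendsto_of_mem [CompleteSpace F] {P : ContinuousPolynomial 𝕜 n E F}
    (hP : P ∈ weaklyContinuousOnBounded 𝕜 n E F) {l : Filter E} [l.NeBot] {r : ℝ}
    (hr : ∀ᶠ x in l, ‖x‖ ≤ r) (hl : ∀ φ : StrongDual 𝕜 E, Cauchy (l.map φ)) :
    ∃ y, Tendsto P l (𝓝 y) :=
  cauchy_map_iff_exists_tendsto.1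
    (IsWeaklyContinuousOnBounded.cauchy_map (𝕜 := 𝕜) hP P.mem_frechetDegreeLT hr hl)

/-- The continuous `(n + 1)`-homogeneous polynomial `x ↦ ψ x ^ n • T x`. -/
def powSMul (n : ℕ) (ψ : StrongDual 𝕜 E) (T : E →L[𝕜] F) : ContinuousPolynomial 𝕜 (n + 1) E F :=
  ⟨fun x => ψ x ^ n • T x, by
    let N := (MultilinearMap.mkPiAlgebra 𝕜 (Fin n) 𝕜).compLinearMap fun _ => (ψ : E →ₗ[𝕜] 𝕜)
    let L : E →ₗ[𝕜] MultilinearMap 𝕜 (fun _ : Fin n => E) F :=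
      { toFun := fun z => N.smulRight (T z)
        map_add' := fun z w => by ext; simp
        map_smul' := fun c z => by ext; simp [smul_comm c] }
    convert isHomogeneousPolynomial_diagonal
      (LinearMap.uncurryLeft (M := fun _ : Fin (n + 1) => E) L)
    simp [L, N, Fin.tail_def], by fun_prop⟩

@[simp] theorem powSMul_apply (ψ : StrongDual 𝕜 E) (T : E →L[𝕜] F) (x : E) :
    powSMul n ψ T x = ψ x ^ n • T x := rfl

theorem norm_powSMul_le (ψ : StrongDual 𝕜 E) (T : E →L[𝕜] F) :
    ‖powSMul n ψ T‖ ≤ ‖ψ‖ ^ n * ‖T‖ :=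
  norm_le fun x hx => by
    rw [powSMul_apply, norm_smul, norm_pow]
    gcongr
    exacts [ψ.unit_le_opNorm x hx, T.unit_le_opNorm x hx]

theorem powSMul_smulRight_mem (ψ χ : StrongDual 𝕜 E) (y : F) :
    powSMul n ψ (χ.smulRight y) ∈ weaklyContinuousOnBounded 𝕜 (n + 1) E F := by
  intro l x₀ _ hl
  have hlim := tendsto_toWeakSpace_iff.1 hl
  exact ⟨ψ x₀ ^ n • χ x₀ • y, ((hlim ψ).pow n).smul ((hlim χ).smul_const y)⟩

/-- Evaluation at a point of `E`, as a linear map on `𝓟(ⁿE, F)`. -/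
def evalₗ (x : E) : ContinuousPolynomial 𝕜 n E F →ₗ[𝕜] F where
  toFun P := P x
  map_add' _ _ := rfl
  map_smul' _ _ := rfl

@[simp] theorem evalₗ_apply (x : E) (P : ContinuousPolynomial 𝕜 n E F) : evalₗ x P = P x := rfl

end ContinuousPolynomial

end HomogeneousPolynomials

namespace IsQuotientMapping

variable {𝕜 : Type*} [RCLike 𝕜]
  {E : Type*} [NormedAddCommGroup E] [NormedSpace 𝕜 E]
  {F : Type*} [NormedAddCommGroup F] [NormedSpace 𝕜 F] {ρ : E →L[𝕜] F}

theorem norm_le_one (hρ : IsQuotientMapping ρ) : ‖ρ‖ ≤ 1 :=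
  ρ.opNorm_le_bound zero_le_one fun x => by
    rw [one_mul]
    exact NormedAddGroupHom.IsQuotient.norm_le hρ x

theorem image_ball (hρ : IsQuotientMapping ρ) : ρ '' ball 0 1 = ball 0 1 := by
  refine Set.Subset.antisymm ?_ fun y hy => ?_
  · rintro _ ⟨x, hx, rfl⟩
    rw [mem_ball_zero_iff] at hx ⊢
    exact (NormedAddGroupHom.IsQuotient.norm_le hρ x).trans_lt hx
  · rw [mem_ball_zero_iff] at hy
    obtain ⟨x, hxy, hx⟩ := NormedAddGroupHom.IsQuotient.norm_lift hρ (sub_pos.2 hy) y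
    exact ⟨x, by simpa using hx, hxy⟩

theorem exists_ultrafilter_tendsto (hρ : IsQuotientMapping ρ)
    {Φ : StrongDual 𝕜 (StrongDual 𝕜 F)} (hΦ : ‖Φ‖ ≤ 1) :
    ∃ U : Ultrafilter E, (∀ᶠ x in (U : Filter E), ‖x‖ ≤ 1) ∧
      ∀ g : StrongDual 𝕜 F, Tendsto (fun x => g (ρ x)) U (𝓝 (Φ g)) := by
  obtain ⟨V, hV, hVΦ⟩ := goldstine hΦ
  rw [← hρ.image_ball] at hV
  refine ⟨.ofComapInfPrincipal hV, ?_, fun g => ?_⟩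
  · filter_upwards [Ultrafilter.ofComapInfPrincipal_mem hV] with x hx
      using (mem_ball_zero_iff.1 hx).le
  · have hmap := congrArg Ultrafilter.toFilter (Ultrafilter.ofComapInfPrincipal_eq_of_map hV)
    exact (hVΦ g).comp hmap.le

end IsQuotientMapping

section MIdeals

variable {𝕜 : Type*} [RCLike 𝕜]

variable {X : Type*} [NormedAddCommGroup X] [NormedSpace 𝕜 X]

theorem IsMIdeal.norm_add_eq {J : Submodule 𝕜 X} (hJ : IsMIdeal 𝕜 X J) {f k : StrongDual 𝕜 X}
    (hf : ‖f‖ ≤ ‖f.comp J.subtypeL‖) (hk : ∀ y ∈ J, k y = 0) : ‖f + k‖ = ‖f‖ + ‖k‖ := by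
  obtain ⟨-, Q, hQ, hnorm⟩ := hJ
  have hQk : Q k = 0 := (hQ.ker_eq k).2 hk
  have hQf_restrict : f.comp J.subtypeL = (Q f).comp J.subtypeL := by
    ext y
    exact sub_eq_zero.1 ((hQ.ker_eq (f - Q f)).1 (by rw [map_sub, hQ.proj, sub_self]) y y.2)
  have hf_le : ‖f‖ ≤ ‖Q f‖ :=
    (hQf_restrict ▸ hf).trans (opNorm_comp_le_of_opNorm_le_one _ J.norm_subtypeL_le)
  have hQf : Q f = f := by
    rw [eq_comm, ← sub_eq_zero, ← norm_le_zero_iff]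
    linarith [hnorm f]
  simpa [hQk, hQf] using hnorm (f + k)

variable {F : Type*} [NormedAddCommGroup F] [NormedSpace 𝕜 F]

set_option maxSynthPendingDepth 6 in
theorem isMIdeal_range_inclusionInDoubleDual [CompleteSpace F]
    (h : ∀ (g : StrongDual 𝕜 F) (k : StrongDual 𝕜 (StrongDual 𝕜 (StrongDual 𝕜 F))),
      (∀ y, k (inclusionInDoubleDual 𝕜 F y) = 0) →
        ‖g‖ + ‖k‖ ≤ ‖inclusionInDoubleDual 𝕜 (StrongDual 𝕜 F) g + k‖) :
    IsMIdeal 𝕜 (StrongDual 𝕜 (StrongDual 𝕜 F))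
      (LinearMap.range (inclusionInDoubleDual 𝕜 F).toLinearMap) := by
  let ι := inclusionInDoubleDual 𝕜 (StrongDual 𝕜 F)
  have hι (g : StrongDual 𝕜 F) : ‖ι g‖ = ‖g‖ :=
    (inclusionInDoubleDualLi 𝕜 (E := StrongDual 𝕜 F)).norm_map g
  let restr : StrongDual 𝕜 (StrongDual 𝕜 (StrongDual 𝕜 F)) →L[𝕜] StrongDual 𝕜 F :=
    (ContinuousLinearMap.compL 𝕜 F (StrongDual 𝕜 (StrongDual 𝕜 F)) 𝕜).flip
      (inclusionInDoubleDual 𝕜 F)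
  have hrestr_le (f) : ‖restr f‖ ≤ ‖f‖ :=
    opNorm_comp_le_of_opNorm_le_one f (inclusionInDoubleDual_norm_le 𝕜 F)
  refine ⟨(inclusionInDoubleDualLi 𝕜 (E := F)).isometry.isClosedEmbedding.isClosed_range,
    ι.comp restr, ⟨fun f => rfl, ?_, fun f => ?_⟩, fun f => le_antisymm ?_ ?_⟩
  · exact ContinuousLinearMap.opNorm_le_bound _ zero_le_one fun f =>
      ((hι _).trans_le (hrestr_le f)).trans_eq (one_mul _).symm
  · rw [← norm_eq_zero, ContinuousLinearMap.comp_apply, hι, norm_eq_zero]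
    constructor
    · rintro hf _ ⟨y, rfl⟩
      exact DFunLike.congr_fun hf y
    · exact fun hf => ContinuousLinearMap.ext fun y => hf _ ⟨y, rfl⟩
  · exact (norm_add_le _ _).trans_eq' (by rw [add_sub_cancel])
  · have hsum := h (restr f) (f - ι (restr f)) fun y => sub_self (f (inclusionInDoubleDual 𝕜 F y))
    rwa [add_sub_cancel, ← hι] at hsum

end MIdeals

section BidualPolynomials

variable {𝕜 : Type*} [RCLike 𝕜] {n : ℕ}
  {E : Type*} [NormedAddCommGroup E] [NormedSpace 𝕜 E]
  {F : Type*} [NormedAddCommGroup F] [NormedSpace 𝕜 F] {ρ : E →L[𝕜] F}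

open ContinuousPolynomial

-- Instance synthesis for norms on third duals exceeds the default pending depth.
set_option maxSynthPendingDepth 6

theorem IsQuotientMapping.exists_bidual_evaluation [CompleteSpace F] (hρ : IsQuotientMapping ρ)
    (n : ℕ) {Φ : StrongDual 𝕜 (StrongDual 𝕜 F)} (hΦ : ‖Φ‖ ≤ 1) :
    ∃ S : ContinuousPolynomial 𝕜 (n + 1) E F →L[𝕜] StrongDual 𝕜 (StrongDual 𝕜 F), ‖S‖ ≤ 1 ∧
      (∀ (φ : StrongDual 𝕜 F) (T : F →L[𝕜] F) (g : StrongDual 𝕜 F),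
        S (powSMul n (φ.comp ρ) (T.comp ρ)) g = Φ φ ^ n * Φ (g.comp T)) ∧
      ∀ P ∈ weaklyContinuousOnBounded 𝕜 (n + 1) E F, ∃ y, S P = inclusionInDoubleDual 𝕜 F y := by
  obtain ⟨U, hU, hUΦ⟩ := hρ.exists_ultrafilter_tendsto hΦ
  obtain ⟨S, hS, hlim⟩ := exists_tendsto_bidual U
    (evalₗ (𝕜 := 𝕜) (n := n + 1) (F := F)) zero_le_one fun P => by
      filter_upwards [hU] with x hx using (P.norm_apply_le hx).trans_eq (one_mul _).symm
  refine ⟨S, hS, fun φ T g => ?_, fun P hP => ?_⟩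
  · refine tendsto_nhds_unique (hlim _ g) ?_
    simpa using ((hUΦ φ).pow n).mul (hUΦ (g.comp T))
  · have hcauchy (ψ : StrongDual 𝕜 E) : Cauchy ((U : Filter E).map ψ) := by
      have hψ : ∀ᶠ x in U, ‖ψ x‖ ≤ ‖ψ‖ := by
        filter_upwards [hU] with x hx using ψ.unit_le_opNorm x hx
      obtain ⟨c, -, hc⟩ := exists_ultrafilter_limit_of_norm_le U hψ
      exact hc.cauchy_map
    obtain ⟨y, hy⟩ := exists_tendsto_of_mem hP hU hcauchy
    refine ⟨y, ContinuousLinearMap.ext fun g => tendsto_nhds_unique (hlim P g) ?_⟩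
    exact (g.continuous.tendsto y).comp hy

theorem IsQuotientMapping.norm_powSMul_comp_le_one (hρ : IsQuotientMapping ρ)
    {φ : StrongDual 𝕜 F} {T : F →L[𝕜] F} (hφ : ‖φ‖ ≤ 1) (hT : ‖T‖ ≤ 1) :
    ‖powSMul n (φ.comp ρ) (T.comp ρ)‖ ≤ 1 :=
  calc ‖powSMul n (φ.comp ρ) (T.comp ρ)‖ ≤ ‖φ.comp ρ‖ ^ n * ‖T.comp ρ‖ := norm_powSMul_le _ _
    _ ≤ (‖φ‖ * ‖ρ‖) ^ n * (‖T‖ * ‖ρ‖) := by gcongr <;> apply ContinuousLinearMap.opNorm_comp_le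
    _ ≤ (1 * 1) ^ n * (1 * 1) := by gcongr <;> exact hρ.norm_le_one
    _ = 1 := by simp only [one_pow, mul_one]

variable {Φ : StrongDual 𝕜 (StrongDual 𝕜 F)}
  {S : ContinuousPolynomial 𝕜 (n + 1) E F →L[𝕜] StrongDual 𝕜 (StrongDual 𝕜 F)}

theorem norm_apply_le_norm_comp (hρ : IsQuotientMapping ρ) (hΦ : ‖Φ‖ = 1)
    (hS : ∀ (φ : StrongDual 𝕜 F) (T : F →L[𝕜] F) (g : StrongDual 𝕜 F),
      S (powSMul n (φ.comp ρ) (T.comp ρ)) g = Φ φ ^ n * Φ (g.comp T))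
    (k : StrongDual 𝕜 (StrongDual 𝕜 (StrongDual 𝕜 F))) : ‖k Φ‖ ≤ ‖k.comp S‖ := by
  have hpow := opNorm_pow_mul_le Φ n (a := ‖k Φ‖) (C := ‖k.comp S‖) fun φ hφ => by
    have hSφ : S (powSMul n (φ.comp ρ) ((ContinuousLinearMap.id 𝕜 F).comp ρ)) = Φ φ ^ n • Φ :=
      ContinuousLinearMap.ext (hS φ (.id 𝕜 F))
    have hP := (k.comp S).unit_le_opNorm _
      (hρ.norm_powSMul_comp_le_one (n := n) hφ ContinuousLinearMap.norm_id_le)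
    rwa [ContinuousLinearMap.comp_apply, hSφ, map_smul, norm_smul, norm_pow] at hP
  rwa [hΦ, one_pow, one_mul] at hpow

theorem norm_le_norm_inclusionInDoubleDual_comp (hρ : IsQuotientMapping ρ) (hΦ : ‖Φ‖ = 1)
    (hS : ∀ (φ : StrongDual 𝕜 F) (T : F →L[𝕜] F) (g : StrongDual 𝕜 F),
      S (powSMul n (φ.comp ρ) (T.comp ρ)) g = Φ φ ^ n * Φ (g.comp T))
    (g : StrongDual 𝕜 F) :
    ‖g‖ ≤ ‖((inclusionInDoubleDual 𝕜 (StrongDual 𝕜 F) g).comp S).comp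
      (weaklyContinuousOnBounded 𝕜 (n + 1) E F).subtypeL‖ := by
  set f := ((inclusionInDoubleDual 𝕜 (StrongDual 𝕜 F) g).comp S).comp
    (weaklyContinuousOnBounded 𝕜 (n + 1) E F).subtypeL
  refine ContinuousLinearMap.opNorm_le_of_unit_norm (norm_nonneg f) fun y hy => ?_
  have hpow := opNorm_pow_mul_le Φ (n + 1) (a := ‖g y‖) (C := ‖f‖) fun φ hφ => by
    have hT : ‖φ.smulRight y‖ ≤ 1 := by
      rw [ContinuousLinearMap.norm_smulRight_apply]
      exact mul_le_one₀ hφ (norm_nonneg y) hy.le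
    have hP := f.unit_le_opNorm
      ⟨powSMul n (φ.comp ρ) ((φ.smulRight y).comp ρ), powSMul_smulRight_mem _ (φ.comp ρ) y⟩
      (hρ.norm_powSMul_comp_le_one hφ hT)
    have hgφ : g.comp (φ.smulRight y) = g y • φ := by
      ext z
      simp [mul_comm]
    have hfP : f ⟨powSMul n (φ.comp ρ) ((φ.smulRight y).comp ρ),
        powSMul_smulRight_mem _ (φ.comp ρ) y⟩ = Φ φ ^ (n + 1) * g y := by
      refine (hS φ (φ.smulRight y) g).trans ?_
      rw [hgφ, map_smul, smul_eq_mul]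
      ring
    rwa [hfP, norm_mul, norm_pow] at hP
  rwa [hΦ, one_pow, one_mul] at hpow

theorem IsQuotientMapping.norm_add_norm_apply_le [CompleteSpace F] (hρ : IsQuotientMapping ρ)
    (hM : IsMIdeal 𝕜 (ContinuousPolynomial 𝕜 (n + 1) E F)
      (weaklyContinuousOnBounded 𝕜 (n + 1) E F))
    (hΦ : ‖Φ‖ = 1) (g : StrongDual 𝕜 F)
    {k : StrongDual 𝕜 (StrongDual 𝕜 (StrongDual 𝕜 F))}
    (hk : ∀ y, k (inclusionInDoubleDual 𝕜 F y) = 0) :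
    ‖g‖ + ‖k Φ‖ ≤ ‖inclusionInDoubleDual 𝕜 (StrongDual 𝕜 F) g + k‖ := by
  obtain ⟨S, hS_le, hS, hSw⟩ := hρ.exists_bidual_evaluation n hΦ.le
  set ι := inclusionInDoubleDual 𝕜 (StrongDual 𝕜 F)
  have hcomp_le (f : StrongDual 𝕜 (StrongDual 𝕜 (StrongDual 𝕜 F))) : ‖f.comp S‖ ≤ ‖f‖ :=
    opNorm_comp_le_of_opNorm_le_one f hS_le
  have hg := norm_le_norm_inclusionInDoubleDual_comp hρ hΦ hS g
  have hg_le : ‖(ι g).comp S‖ ≤ ‖g‖ := (hcomp_le _).trans (double_dual_bound 𝕜 _ g)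
  have hkS : ∀ P ∈ weaklyContinuousOnBounded 𝕜 (n + 1) E F, k.comp S P = 0 := fun P hP => by
    obtain ⟨y, hy⟩ := hSw P hP
    rw [ContinuousLinearMap.comp_apply, hy, hk]
  calc ‖g‖ + ‖k Φ‖ ≤ ‖(ι g).comp S‖ + ‖k.comp S‖ :=
        add_le_add
          (hg.trans (opNorm_comp_le_of_opNorm_le_one _ (Submodule.norm_subtypeL_le _)))
          (norm_apply_le_norm_comp hρ hΦ hS k)
    _ = ‖(ι g + k).comp S‖ := (hM.norm_add_eq (hg_le.trans hg) hkS).symm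
    _ ≤ ‖ι g + k‖ := hcomp_le _

theorem IsQuotientMapping.norm_add_norm_le [CompleteSpace F] (hρ : IsQuotientMapping ρ)
    (hM : IsMIdeal 𝕜 (ContinuousPolynomial 𝕜 (n + 1) E F)
      (weaklyContinuousOnBounded 𝕜 (n + 1) E F))
    (g : StrongDual 𝕜 F) {k : StrongDual 𝕜 (StrongDual 𝕜 (StrongDual 𝕜 F))}
    (hk : ∀ y, k (inclusionInDoubleDual 𝕜 F y) = 0) :
    ‖g‖ + ‖k‖ ≤ ‖inclusionInDoubleDual 𝕜 (StrongDual 𝕜 F) g + k‖ := by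
  set f := inclusionInDoubleDual 𝕜 (StrongDual 𝕜 F) g + k
  have hfg : f.comp (inclusionInDoubleDual 𝕜 F) = g := by
    ext y
    simp [f, hk]
  have hg : ‖g‖ ≤ ‖f‖ := by
    rw [← hfg]
    exact opNorm_comp_le_of_opNorm_le_one f (inclusionInDoubleDual_norm_le 𝕜 F)
  have hk_le : ‖k‖ ≤ ‖f‖ - ‖g‖ :=
    ContinuousLinearMap.opNorm_le_of_unit_norm (sub_nonneg.2 hg) fun Φ hΦ =>
      le_sub_iff_add_le'.2 (hρ.norm_add_norm_apply_le hM hΦ g hk)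
  exact le_sub_iff_add_le'.1 hk_le

end BidualPolynomials

theorem corollary4p7_general {𝕜 : Type*} [RCLike 𝕜]
    {E : Type*} [NormedAddCommGroup E] [NormedSpace 𝕜 E]
    {F : Type*} [NormedAddCommGroup F] [NormedSpace 𝕜 F] [CompleteSpace F]
    (ρ : E →L[𝕜] F) (hρ : IsQuotientMapping ρ)
    (h : ∃ n : ℕ, 1 ≤ n ∧ IsMIdeal 𝕜 (ContinuousPolynomial 𝕜 n E F)
      (ContinuousPolynomial.weaklyContinuousOnBounded 𝕜 n E F)) :
    IsMIdeal 𝕜 (StrongDual 𝕜 (StrongDual 𝕜 F))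
      (LinearMap.range (NormedSpace.inclusionInDoubleDual 𝕜 F).toLinearMap) := by
  obtain ⟨n, hn, hM⟩ := h
  obtain ⟨m, rfl⟩ := Nat.exists_eq_add_of_le' hn
  exact isMIdeal_range_inclusionInDoubleDual fun g _ hk => hρ.norm_add_norm_le hM g hk

/-- If `F` is the image of `E` under a quotient mapping and `𝓟_w(ⁿE, F)` is an `M`-ideal in
`𝓟(ⁿE, F)` for some `n ≥ 1`, then `F` is an `M`-ideal in its bidual. -/
theorem corollary4p7 {𝕜 : Type*} [RCLike 𝕜]
    {E : Type*} [NormedAddCommGroup E] [NormedSpace 𝕜 E] [CompleteSpace E]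
    {F : Type*} [NormedAddCommGroup F] [NormedSpace 𝕜 F] [CompleteSpace F]
    (ρ : E →L[𝕜] F) (hρ : IsQuotientMapping ρ)
    (h : ∃ n : ℕ, 1 ≤ n ∧ IsMIdeal 𝕜 (ContinuousPolynomial 𝕜 n E F)
      (ContinuousPolynomial.weaklyContinuousOnBounded 𝕜 n E F)) :
    IsMIdeal 𝕜 (StrongDual 𝕜 (StrongDual 𝕜 F))
      (LinearMap.range (NormedSpace.inclusionInDoubleDual 𝕜 F).toLinearMap) :=
  corollary4p7_general ρ hρ h
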